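/- Let $\mathbf{m}=(m_i)_{i\ge 0}$ be a sequence of integers with $m_i\ge 2$ for all $i$, and let $\alpha:\mathbb{Z}_{\ge 0}\to(0,\infty)$ be a strictly decreasing sequence converging to $0$. Let $S(\mathbf{m})$ be the set of all sequences $x=(x(i))_{i\ge 0}$ with $x(i)\in\{0,1,\dots,m_i-1\}$ for all $i$, equipped with the ultrametric $\alpha_\sharp$ given by $\alpha_\sharp(x,x)=0$ and, for $x\ne y$, $\alpha_\sharp(x,y)=\alpha(v(x,y))$, where $v(x,y)=\min\{n\ge 0: x(n)\neq y(n)\}$. The space $(S(\mathbf{m}),\alpha_\sharp)$ is the $(\mathbf{m},\alpha)$-Cantor ultrametric space. Let $\dim_H$ denote the Hausdorff dimension, and let $\dim_P$ denote the packing dimension of radius type, defined as follows. For a metric space $X$, $A\subseteq X$, $s\ge 0$ and $\delta>0$, let $\widetilde{\mathcal P}^s_\delta(A)$ be the supremum of $\sum_i r_i^s$ over all finite or countable families of pairwise disjoint closed balls $B(x_i,r_i)$ of $X$ with $x_i\in A$ and $0<r_i<\delta$; put $\widetilde{\mathcal P}^s_0(A)=\inf_{\delta>0}\widetilde{\mathcal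 P}^s_\delta(A)$ and $\mathcal P^s(A)=\inf\{\sum_{i=1}^\infty\widetilde{\mathcal P}^s_0(S_i): A\subseteq\bigcup_{i=1}^\infty S_i\}$; then $\dim_P X=\sup\{s\in[0,\infty):\mathcal P^s(X)=\infty\}\in[0,\infty]$. Then, as elements of $[0,\infty]$, $$\dim_H(S(\mathbf{m}),\alpha_\sharp)=\liminf_{n\to\infty}\frac{\log(m_0\cdots m_n)}{-\log\alpha(n+1)},\qquad \dim_P(S(\mathbf{m}),\alpha_\sharp)=\limsup_{n\to\infty}\frac{\log(m_0\cdots m_n)}{-\log\alpha(n)}.$$ (The quotients are considered for $n$ so large that $\alpha(n)<1$.) -/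

import Mathlib

open Set Filter Topology
open scoped ENNReal NNReal

noncomputable section

/-! ### Packing measures (radius type) and packing dimension -/

section Packing

variable {X : Type*} [MetricSpace X]

/-- `IsPacking A δ x r`: the balls `B(x i, r i)`, `i ∈ I`, are pairwise disjoint closed balls
with centres in `A` and radii in `(0, δ)`. -/
structure IsPacking (A : Set X) (δ : ℝ) {I : Set ℕ} (x : I → X) (r : I → ℝ) : Prop where
  center_mem : ∀ i, x i ∈ A
  radius_pos : ∀ i, 0 < r i
  radius_lt : ∀ i, r i < δ
  disjoint : ∀ i j, i ≠ j →
    Disjoint (Metric.closedBall (x i) (r i)) (Metric.closedBall (x j) (r j))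

/-- The supremum of `∑ (r i) ^ s` over all finite or countable packings of `A` by disjoint closed
balls of radii smaller than `δ`. The index sets of the families range over all subsets of `ℕ`. -/
def prePackingDelta (s : ℝ) (δ : ℝ) (A : Set X) : ℝ≥0∞ :=
  ⨆ (I : Set ℕ) (x : I → X) (r : I → ℝ) (_ : IsPacking A δ x r),
    ∑' i, ENNReal.ofReal (r i) ^ s

/-- The `s`-dimensional pre-packing measure. -/
def prePacking (s : ℝ) (A : Set X) : ℝ≥0∞ :=
  ⨅ (δ : ℝ) (_ : 0 < δ), prePackingDelta s δ A

/-- The `s`-dimensional packing measure. -/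
def packingMeasure (s : ℝ) (A : Set X) : ℝ≥0∞ :=
  ⨅ (S : ℕ → Set X) (_ : A ⊆ ⋃ i, S i), ∑' i, prePacking s (S i)

variable (X) in
/-- The packing dimension of the metric space `X`: the supremum of all `s ∈ [0, ∞)` for which the
`s`-dimensional packing measure of `X` is infinite. -/
def packingDim : ℝ≥0∞ :=
  ⨆ (s : ℝ≥0) (_ : packingMeasure (s : ℝ) (univ : Set X) = ∞), (s : ℝ≥0∞)

end Packing

/-! ### Cantor ultrametric spaces -/

/-- A shrinking sequence: a strictly decreasing sequence of positive reals that converges to `0`. -/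
structure ShrinkingSeq where
  toFun : ℕ → ℝ
  pos : ∀ n, 0 < toFun n
  strictAnti : StrictAnti toFun
  tendsto_zero : Tendsto toFun atTop (𝓝 0)

instance : CoeFun ShrinkingSeq (fun _ => ℕ → ℝ) := ⟨ShrinkingSeq.toFun⟩

/-- The points of the `(m, α)`-Cantor ultrametric space: all sequences `x` with
`x i ∈ {0, …, m i - 1}`. The parameter `α` determines the metric. -/
@[ext]
structure CantorUltrametric (m : ℕ → ℕ) (α : ShrinkingSeq) where
  seq : ∀ i, Fin (m i)

namespace CantorUltrametric

variable {m : ℕ → ℕ} {α : ShrinkingSeq}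

/-- The distance `α (v(x, y))`, where `v(x, y)` is the least index at which `x` and `y` differ,
and the distance is `0` if `x = y`. -/
instance : Dist (CantorUltrametric m α) where
  dist x y := open scoped Classical in
    if x = y then 0 else α (PiNat.firstDiff x.seq y.seq)

theorem dist_self' (x : CantorUltrametric m α) : dist x x = 0 := if_pos rfl

theorem dist_of_ne {x y : CantorUltrametric m α} (h : x ≠ y) :
    dist x y = α (PiNat.firstDiff x.seq y.seq) := if_neg h

theorem dist_nonneg' (x y : CantorUltrametric m α) : 0 ≤ dist x y := by
  by_cases h : x = y
  · rw [h, dist_self']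
  · rw [dist_of_ne h]; exact (α.pos _).le

theorem dist_comm' (x y : CantorUltrametric m α) : dist x y = dist y x := by
  by_cases h : x = y
  · rw [h]
  · rw [dist_of_ne h, dist_of_ne (Ne.symm h), PiNat.firstDiff_comm]

theorem dist_le_max (x y z : CantorUltrametric m α) : dist x z ≤ max (dist x y) (dist y z) := by
  by_cases hxz : x = z
  · rw [hxz, dist_self']; exact le_max_of_le_left (dist_nonneg' _ _)
  by_cases hxy : x = y
  · rw [hxy]; exact le_max_right _ _
  by_cases hyz : y = z
  · rw [hyz]; exact le_max_left _ _
  rw [dist_of_ne hxz, dist_of_ne hxy, dist_of_ne hyz, ← α.strictAnti.antitone.map_min]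
  exact α.strictAnti.antitone (PiNat.min_firstDiff_le x.seq y.seq z.seq
    fun h => hxz (CantorUltrametric.ext h))

instance : MetricSpace (CantorUltrametric m α) where
  dist_self := dist_self'
  dist_comm := dist_comm'
  dist_triangle x y z := (dist_le_max x y z).trans
    (max_le_add_of_nonneg (dist_nonneg' _ _) (dist_nonneg' _ _))
  eq_of_dist_eq_zero {x y} h := by
    by_contra hne
    rw [dist_of_ne hne] at h
    exact (α.pos _).ne' h

instance : IsUltrametricDist (CantorUltrametric m α) := ⟨dist_le_max⟩

end CantorUltrametric

end

open MeasureTheory ProbabilityTheory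

section RealEstimates

/-! Write `N n = m 0 ⋯ m (n-1)`. Closed balls of radius `α n` are the `N n` cylinders of level `n`,
each of mass `1 / N n` for the uniform product measure `μ`. Both dimensions compare this mass with
powers of the radius; the present lemma turns that comparison into one between the exponent and the
log quotient.

Hausdorff: covering by all cylinders of level `n` gives the upper bound, the mass distribution
principle for `μ` the lower one.

Packing: no distance lies strictly between `α (n+1)` and `α n`, so a ball of radius just below `α n`
is still only a cylinder of level `n+1`. Hence `N (n+1)` is paired with `α n`. Above, disjoint balls
have total mass at most 1. Below, any countable cover contains a set of positive outer measure,
which meets a fixed proportion of the cylinders and so has large packings. -/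

theorem natCast_mul_rpow_lt_one_iff {N : ℕ} (hN : 0 < N) {a : ℝ} (ha : 0 < a) (ha1 : a < 1)
    (s : ℝ) :
    (N : ℝ≥0∞) * ENNReal.ofReal a ^ s < 1 ↔ Real.log N / (-Real.log a) < s := by
  have hN' : (0 : ℝ) < N := by exact_mod_cast hN
  have hpos : 0 < (N : ℝ) * a ^ s := mul_pos hN' (Real.rpow_pos_of_pos ha s)
  rw [ENNReal.ofReal_rpow_of_pos ha, ← ENNReal.ofReal_natCast, ← ENNReal.ofReal_mul hN'.le,
    ENNReal.ofReal_lt_one, ← Real.log_neg_iff hpos,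
    Real.log_mul hN'.ne' (Real.rpow_pos_of_pos ha s).ne', Real.log_rpow ha,
    div_lt_iff₀ (neg_pos.2 (Real.log_neg ha ha1))]
  constructor <;> intro h <;> linarith

theorem log_natCast_div_neg_log_nonneg (N : ℕ) {a : ℝ} (ha : 0 < a) (ha1 : a < 1) :
    0 ≤ Real.log N / (-Real.log a) :=
  div_nonneg (Real.log_natCast_nonneg N) (neg_pos.2 (Real.log_neg ha ha1)).le

end RealEstimates

section PackingLemmas

variable {X : Type*} [MetricSpace X]

/-- Packings indexed by an arbitrary countable type bound `prePackingDelta` from below. -/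
theorem tsum_le_prePackingDelta {ι : Type*} [Countable ι] {s δ : ℝ} {A : Set X} {x : ι → X}
    {r : ι → ℝ} (hx : ∀ i, x i ∈ A) (hr : ∀ i, 0 < r i) (hδ : ∀ i, r i < δ)
    (hd : ∀ i j, i ≠ j →
      Disjoint (Metric.closedBall (x i) (r i)) (Metric.closedBall (x j) (r j))) :
    ∑' i, ENNReal.ofReal (r i) ^ s ≤ prePackingDelta s δ A := by
  obtain ⟨f, hf⟩ := exists_injective_nat ι
  let e := Equiv.ofInjective f hf
  have hp : IsPacking A δ (x ∘ e.symm) (r ∘ e.symm) :=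
    ⟨fun i => hx _, fun i => hr _, fun i => hδ _,
      fun i j hij => hd _ _ (e.symm.injective.ne hij)⟩
  calc ∑' i, ENNReal.ofReal (r i) ^ s
      = ∑' i, ENNReal.ofReal ((r ∘ e.symm) i) ^ s :=
        (e.symm.tsum_eq fun i => ENNReal.ofReal (r i) ^ s).symm
    _ ≤ prePackingDelta s δ A :=
        le_iSup_of_le (range f) <| le_iSup_of_le _ <| le_iSup_of_le _ <| le_iSup_of_le hp le_rfl

theorem prePacking_empty (s : ℝ) : prePacking s (∅ : Set X) = 0 := by
  refine le_antisymm ((iInf₂_le 1 one_pos).trans ?_) bot_le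
  refine iSup_le fun I => iSup_le fun x => iSup_le fun r => iSup_le fun h => ?_
  have : IsEmpty I := ⟨fun i => h.center_mem i⟩
  simp

theorem packingMeasure_le_prePacking (s : ℝ) (A : Set X) :
    packingMeasure s A ≤ prePacking s A := by
  refine (iInf₂_le (fun n : ℕ => if n = 0 then A else ∅)
    fun x hx => mem_iUnion.2 ⟨0, by simpa using hx⟩).trans ?_
  rw [tsum_eq_single 0 fun n hn => by simp [hn, prePacking_empty]]
  simp

/-- If the `s`-th powers of small radii are bounded by the measures of the corresponding balls,
then the packing measure is bounded by the total mass. -/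
theorem packingMeasure_univ_le_of_rpow_le_measure [MeasurableSpace X] [BorelSpace X]
    (μ : Measure X) {s δ : ℝ} (hδ : 0 < δ)
    (h : ∀ x : X, ∀ r : ℝ, 0 < r → r < δ →
      ENNReal.ofReal r ^ s ≤ μ (Metric.closedBall x r)) :
    packingMeasure s (univ : Set X) ≤ μ univ := by
  refine (packingMeasure_le_prePacking s _).trans ((iInf₂_le δ hδ).trans ?_)
  refine iSup_le fun I => iSup_le fun x => iSup_le fun r => iSup_le fun hp => ?_
  calc ∑' i, ENNReal.ofReal (r i) ^ s
      ≤ ∑' i, μ (Metric.closedBall (x i) (r i)) :=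
        ENNReal.tsum_le_tsum fun i => h _ _ (hp.radius_pos i) (hp.radius_lt i)
    _ = μ (⋃ i, Metric.closedBall (x i) (r i)) :=
        (measure_iUnion (fun i j hij => hp.disjoint i j hij)
          fun i => Metric.isClosed_closedBall.measurableSet).symm
    _ ≤ μ univ := measure_mono (subset_univ _)

/-- If all sets of positive measure have infinite pre-packing measure, the packing measure of the
space is infinite. -/
theorem packingMeasure_univ_eq_top_of_prePacking [MeasurableSpace X] (μ : Measure X) [NeZero μ]
    {s : ℝ} (h : ∀ A : Set X, μ A ≠ 0 → prePacking s A = ∞) :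
    packingMeasure s (univ : Set X) = ∞ := by
  refine iInf₂_eq_top.2 fun S hS => ?_
  obtain ⟨i, hi⟩ : ∃ i, μ (S i) ≠ 0 := by
    by_contra! hzero
    have : μ univ = 0 := measure_mono_null hS (measure_iUnion_null hzero)
    exact NeZero.ne μ (Measure.measure_univ_eq_zero.1 this)
  exact ENNReal.tsum_eq_top_of_eq_top ⟨i, h _ hi⟩

end PackingLemmas

/-! ### Cylinders and balls -/

namespace CantorUltrametric

variable {m : ℕ → ℕ} {α : ShrinkingSeq}

/-- The number of cylinders of level `n`. -/
def cylinderCount (m : ℕ → ℕ) (n : ℕ) : ℕ := ∏ i ∈ Finset.range n, m i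

/-- The first `n` coordinates of a point. -/
def initialSegment (n : ℕ) (x : CantorUltrametric m α) : ∀ i : Fin n, Fin (m i) := fun i => x.seq i

theorem dist_le_iff {x y : CantorUltrametric m α} {n : ℕ} :
    dist x y ≤ α n ↔ initialSegment n x = initialSegment n y := by
  have hseg : initialSegment n x = initialSegment n y ↔ x.seq ∈ PiNat.cylinder y.seq n := by
    simp [initialSegment, funext_iff, PiNat.cylinder, Fin.forall_iff]
  rw [hseg]
  by_cases h : x = y
  · subst h
    simp [(α.pos n).le]
  · rw [dist_of_ne h, α.strictAnti.le_iff_ge,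
      PiNat.mem_cylinder_iff_le_firstDiff fun h' => h (CantorUltrametric.ext h')]

theorem dist_le_succ {x y : CantorUltrametric m α} {n : ℕ} (h : dist x y < α n) :
    dist x y ≤ α (n + 1) := by
  by_cases hxy : x = y
  · rw [hxy, dist_self]
    exact (α.pos _).le
  · rw [dist_of_ne hxy] at h ⊢
    exact α.strictAnti.antitone (Nat.succ_le_of_lt (α.strictAnti.lt_iff_gt.1 h))

theorem closedBall_eq_of_mem_Ico (x : CantorUltrametric m α) {n : ℕ} {r : ℝ}
    (h1 : α (n + 1) ≤ r) (h2 : r < α n) :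
    Metric.closedBall x r = Metric.closedBall x (α (n + 1)) := by
  refine Subset.antisymm (fun y hy => ?_) (Metric.closedBall_subset_closedBall h1)
  exact dist_le_succ (lt_of_le_of_lt hy h2)

theorem closedBall_eq_preimage (x : CantorUltrametric m α) (n : ℕ) :
    Metric.closedBall x (α n) = initialSegment n ⁻¹' {initialSegment n x} := by
  ext y
  simp [dist_le_iff]

theorem card_segments (m : ℕ → ℕ) (n : ℕ) :
    Fintype.card (∀ i : Fin n, Fin (m i)) = cylinderCount m n := by
  simp [cylinderCount, Fin.prod_univ_eq_prod_range]

theorem exists_mem_Ico {r : ℝ} (hr : 0 < r) {k : ℕ} (hk : r < α k) :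
    ∃ n, k ≤ n ∧ α (n + 1) ≤ r ∧ r < α n := by
  obtain ⟨n, hn⟩ := (α.tendsto_zero.eventually_lt_const hr).exists
  have hex : ∃ n, α n ≤ r := ⟨n, hn.le⟩
  classical
  obtain ⟨l, hl⟩ : ∃ l, Nat.find hex = l + 1 := Nat.exists_eq_succ_of_ne_zero fun h0 => by
    have := Nat.find_spec hex
    rw [h0] at this
    exact absurd (hk.trans_le (α.strictAnti.antitone k.zero_le)) this.not_gt
  have hlt : r < α l := not_le.1 (Nat.find_min hex (by omega))
  have hle : α (l + 1) ≤ r := hl ▸ Nat.find_spec hex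
  have : k < l + 1 := α.strictAnti.lt_iff_gt.1 (hle.trans_lt hk)
  exact ⟨l, by omega, hle, hlt⟩

noncomputable instance : MeasurableSpace (CantorUltrametric m α) := borel _

instance : BorelSpace (CantorUltrametric m α) := ⟨rfl⟩

theorem continuous_mk :
    Continuous (CantorUltrametric.mk : (∀ i, Fin (m i)) → CantorUltrametric m α) := by
  rw [continuous_iff_continuousAt]
  intro x
  refine Metric.tendsto_nhds.2 fun ε hε => ?_
  obtain ⟨n, hn⟩ := (α.tendsto_zero.eventually_lt_const hε).exists
  have hopen : ∀ i ∈ Finset.range n, ∀ᶠ y : ∀ i, Fin (m i) in 𝓝 x, y i = x i := fun i _ =>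
    (continuous_apply i).continuousAt.eventually
      ((isOpen_discrete {x i}).mem_nhds (mem_singleton (x i)))
  filter_upwards [(Filter.eventually_all_finset _).2 hopen] with y hy
  refine lt_of_le_of_lt (dist_le_iff.2 ?_) hn
  funext i
  exact hy i (Finset.mem_range.2 i.2)

/-- Covers by all cylinders of one level suffice; infinitely many good levels are enough because the
bound is a liminf. -/
theorem hausdorffMeasure_univ_le_one {s : ℝ} (hs : 0 ≤ s)
    (h : ∃ᶠ n in atTop, (cylinderCount m n : ℝ≥0∞) * ENNReal.ofReal (α n) ^ s ≤ 1) :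
    Measure.hausdorffMeasure s (univ : Set (CantorUltrametric m α)) ≤ 1 := by
  have hdiam : ∀ n, ∀ c : ∀ i : Fin n, Fin (m i),
      Metric.ediam (initialSegment (α := α) n ⁻¹' {c}) ≤ ENNReal.ofReal (α n) := fun n c =>
    Metric.ediam_le fun x hx y hy => by
      rw [edist_dist]
      exact ENNReal.ofReal_le_ofReal (dist_le_iff.2 (hx.trans hy.symm))
  refine (Measure.hausdorffMeasure_le_liminf_sum s univ (l := atTop) (fun n => ENNReal.ofReal (α n)) ?_
    (fun n (c : ∀ i : Fin n, Fin (m i)) => initialSegment n ⁻¹' {c})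
    (.of_forall hdiam) (.of_forall fun n x _ => mem_iUnion.2 ⟨_, rfl⟩)).trans ?_
  · simpa using ENNReal.tendsto_ofReal α.tendsto_zero
  · refine liminf_le_of_frequently_le' (h.mono fun n hn => le_trans ?_ hn)
    refine (Finset.sum_le_sum fun c _ => ENNReal.rpow_le_rpow (hdiam n c) hs).trans ?_
    rw [Finset.sum_const, nsmul_eq_mul, Finset.card_univ, card_segments]

theorem tendsto_inv_cylinderCount (hm : ∀ i, 2 ≤ m i) :
    Tendsto (fun n => (cylinderCount m n : ℝ≥0∞)⁻¹) atTop (𝓝 0) := by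
  refine tendsto_inv_iff.1 ?_
  simp only [inv_inv, ENNReal.inv_zero]
  refine ENNReal.tendsto_nat_nhds_top.comp (tendsto_atTop_mono (fun n => ?_)
    (tendsto_pow_atTop_atTop_of_one_lt (one_lt_two : (1 : ℕ) < 2)))
  simpa [cylinderCount] using
    Finset.prod_le_prod (s := Finset.range n) (fun _ _ => Nat.zero_le _) fun i _ => hm i

theorem log_quotient_nonneg_eventually (c k : ℕ → ℕ) (hk : Tendsto k atTop atTop) :
    ∀ᶠ n in atTop, (0 : EReal) ≤
      ((Real.log (c n) / (-Real.log (α (k n))) : ℝ) : EReal) := by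
  filter_upwards [hk.eventually (α.tendsto_zero.eventually_lt_const one_pos)] with n hn
  exact_mod_cast log_natCast_div_neg_log_nonneg _ (α.pos _) hn

/-! ### The uniform measure and mass estimates -/

variable [∀ i, NeZero (m i)]

theorem cylinderCount_pos (n : ℕ) : 0 < cylinderCount m n :=
  Finset.prod_pos fun i _ => NeZero.pos (m i)

variable (m α) in
/-- The product of the uniform probability measures on the coordinates. -/
noncomputable def uniformMeasure : Measure (CantorUltrametric m α) :=
  (Measure.infinitePi fun i => uniformOn (univ : Set (Fin (m i)))).map CantorUltrametric.mk

instance : IsProbabilityMeasure (uniformMeasure m α) :=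
  Measure.isProbabilityMeasure_map continuous_mk.measurable.aemeasurable

theorem uniformMeasure_closedBall (x : CantorUltrametric m α) (n : ℕ) :
    uniformMeasure m α (Metric.closedBall x (α n)) = (cylinderCount m n : ℝ≥0∞)⁻¹ := by
  have hpre : CantorUltrametric.mk ⁻¹' Metric.closedBall x (α n) =
      Set.pi (Finset.range n) fun i => {x.seq i} := by
    ext y
    simp [dist_le_iff, initialSegment, funext_iff, Fin.forall_iff]
  rw [uniformMeasure, Measure.map_apply continuous_mk.measurable
    Metric.isClosed_closedBall.measurableSet, hpre, Measure.infinitePi_pi _ (by simp)]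
  simp only [uniformOn_univ, Measure.count_singleton, Fintype.card_fin, one_div, cylinderCount,
    Nat.cast_prod]
  exact (ENNReal.prod_inv_distrib fun i _ j _ _ => Or.inl (by simp [NeZero.ne])).symm

theorem uniformMeasure_le_of_diam_le {A : Set (CantorUltrametric m α)} {n : ℕ}
    (h : ∀ x ∈ A, ∀ y ∈ A, dist x y ≤ α n) :
    uniformMeasure m α A ≤ (cylinderCount m n : ℝ≥0∞)⁻¹ := by
  rcases A.eq_empty_or_nonempty with rfl | ⟨x, hx⟩
  · simp
  · rw [← uniformMeasure_closedBall x n]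
    exact measure_mono fun y hy => h y hy x hx

/-- The number of cylinders of level `n` that meet `A` is at least the total number times the
measure of `A`. -/
theorem cylinderCount_mul_uniformMeasure_le (A : Set (CantorUltrametric m α)) (n : ℕ) :
    (cylinderCount m n : ℝ≥0∞) * uniformMeasure m α A ≤
      (Nat.card (initialSegment n '' A : Set (∀ i : Fin n, Fin (m i))) : ℝ≥0∞) := by
  classical
  have hc : (cylinderCount m n : ℝ≥0∞) ≠ 0 := by
    exact_mod_cast (cylinderCount_pos (m := m) n).ne'
  have hcover : A ⊆ ⋃ c : (initialSegment n '' A : Set (∀ i : Fin n, Fin (m i))),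
      initialSegment n ⁻¹' {c.1} := fun x hx =>
    mem_iUnion.2 ⟨⟨_, mem_image_of_mem _ hx⟩, rfl⟩
  have hle : uniformMeasure m α A ≤
      ∑ _c : (initialSegment n '' A : Set (∀ i : Fin n, Fin (m i))),
        (cylinderCount m n : ℝ≥0∞)⁻¹ := by
    refine (measure_mono hcover).trans ((measure_iUnion_fintype_le _ _).trans ?_)
    refine Finset.sum_le_sum fun c _ => ?_
    obtain ⟨x, -, hx⟩ := c.2
    rw [← hx, ← closedBall_eq_preimage, uniformMeasure_closedBall]
  calc (cylinderCount m n : ℝ≥0∞) * uniformMeasure m α A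
      ≤ (cylinderCount m n : ℝ≥0∞) * _ := mul_le_mul_right hle _
    _ = _ := by
      rw [Finset.sum_const, nsmul_eq_mul, mul_left_comm,
        ENNReal.mul_inv_cancel hc (ENNReal.natCast_ne_top _), mul_one, Finset.card_univ,
        Nat.card_eq_fintype_card]

theorem uniformMeasure_le_hausdorffMeasure (hm : ∀ i, 2 ≤ m i) {s : ℝ} (hs : 0 ≤ s)
    (h : ∀ᶠ n in atTop, 1 ≤ (cylinderCount m n : ℝ≥0∞) * ENNReal.ofReal (α n) ^ s) :
    uniformMeasure m α ≤ Measure.hausdorffMeasure s := by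
  obtain ⟨k, hk⟩ := eventually_atTop.1 h
  refine Measure.le_hausdorffMeasure s _ (ENNReal.ofReal (α k))
    (ENNReal.ofReal_pos.2 (α.pos k)) fun A hA => ?_
  by_cases hsub : A.Subsingleton
  -- A set with at most one point lies in cylinders of every level, so it is null; here `2 ≤ m i`
  -- enters.
  · refine (ge_of_tendsto' (tendsto_inv_cylinderCount hm) fun n =>
      uniformMeasure_le_of_diam_le fun x hx y hy => ?_).trans bot_le
    rw [hsub hx hy, dist_self]
    exact (α.pos n).le
  classical
  obtain ⟨x₀, hx₀, y₀, hy₀, hne₀⟩ := not_subsingleton_iff.1 hsub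
  -- The least such index `n` makes the diameter of `A` an attained distance, equal to `α n`.
  have hex : ∃ n, ∃ x ∈ A, ∃ y ∈ A, x ≠ y ∧ PiNat.firstDiff x.seq y.seq = n :=
    ⟨_, x₀, hx₀, y₀, hy₀, hne₀, rfl⟩
  obtain ⟨x, hx, y, hy, hne, hxy⟩ := Nat.find_spec hex
  set n := Nat.find hex
  have hle : ∀ x ∈ A, ∀ y ∈ A, dist x y ≤ α n := fun x' hx' y' hy' => by
    by_cases hne' : x' = y'
    · rw [hne', dist_self]
      exact (α.pos n).le
    · rw [dist_of_ne hne']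
      exact α.strictAnti.antitone (Nat.find_min' hex ⟨x', hx', y', hy', hne', rfl⟩)
  have hdiam : ENNReal.ofReal (α n) ≤ Metric.ediam A := by
    rw [← hxy, ← dist_of_ne hne, ← edist_dist]
    exact Metric.edist_le_ediam_of_mem hx hy
  have hkn : k ≤ n := α.strictAnti.le_iff_ge.1
    ((ENNReal.ofReal_le_ofReal_iff (α.pos k).le).1 (hdiam.trans hA))
  calc uniformMeasure m α A ≤ (cylinderCount m n : ℝ≥0∞)⁻¹ := uniformMeasure_le_of_diam_le hle
    _ ≤ ENNReal.ofReal (α n) ^ s := by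
      refine ENNReal.inv_le_iff_le_mul ?_ ?_ |>.2 (hk n hkn)
      · simp [(α.pos n).not_ge]
      · simp [(α.pos n).not_ge]
    _ ≤ Metric.ediam A ^ s := ENNReal.rpow_le_rpow hdiam hs

/-! ### Packing measure bounds -/

theorem packingMeasure_univ_le_one {s : ℝ} (hs : 0 ≤ s)
    (h : ∀ᶠ n in atTop, (cylinderCount m (n + 1) : ℝ≥0∞) * ENNReal.ofReal (α n) ^ s ≤ 1) :
    packingMeasure s (univ : Set (CantorUltrametric m α)) ≤ 1 := by
  obtain ⟨k, hk⟩ := eventually_atTop.1 h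
  rw [← measure_univ (μ := uniformMeasure m α)]
  refine packingMeasure_univ_le_of_rpow_le_measure _ (α.pos k) fun x r hr hrk => ?_
  obtain ⟨n, hkn, h1, h2⟩ := exists_mem_Ico hr hrk
  rw [closedBall_eq_of_mem_Ico x h1 h2, uniformMeasure_closedBall]
  refine (ENNReal.rpow_le_rpow (ENNReal.ofReal_le_ofReal h2.le) hs).trans ?_
  rw [← one_div, ENNReal.le_div_iff_mul_le (Or.inl ?_) (Or.inl (ENNReal.natCast_ne_top _)),
    mul_comm]
  · exact hk n hkn
  · exact_mod_cast (cylinderCount_pos (m := m) _).ne'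

/-- Choose one centre in `A` from each cylinder of level `n+1` that meets `A`; the balls are those
cylinders, hence disjoint. -/
theorem le_prePackingDelta {s δ : ℝ} (hs : 0 ≤ s) (A : Set (CantorUltrametric m α)) {n : ℕ}
    (hn : α n ≤ δ) :
    (cylinderCount m (n + 1) : ℝ≥0∞) * uniformMeasure m α A * ENNReal.ofReal (α n / 2) ^ s ≤
      prePackingDelta s δ A := by
  classical
  have hpos := α.pos n
  have hlt := α.strictAnti n.lt_succ_self
  -- Radii must be below `α n`. This one is comparable to `α n` and stays in the range where balls
  -- are cylinders of level `n+1`.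
  set r := max (α (n + 1)) (α n / 2)
  have hrn : r < α n := max_lt hlt (by linarith)
  have hr : 0 < r := lt_max_of_lt_left (α.pos _)
  choose x hxA hx using fun c : (initialSegment (n + 1) '' A : Set (∀ i : Fin (n + 1), Fin (m i)))
    => c.2
  refine le_trans ?_ (tsum_le_prePackingDelta (s := s) hxA (r := fun _ => r) (fun _ => hr)
    (fun _ => hrn.trans_le hn) fun c d hcd => ?_)
  · rw [tsum_fintype, Finset.sum_const, nsmul_eq_mul, Finset.card_univ, ← Nat.card_eq_fintype_card]
    gcongr
    · exact cylinderCount_mul_uniformMeasure_le A (n + 1)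
    · exact le_max_right _ _
  · rw [closedBall_eq_of_mem_Ico _ (le_max_left _ _) hrn,
      closedBall_eq_of_mem_Ico _ (le_max_left _ _) hrn, closedBall_eq_preimage,
      closedBall_eq_preimage, hx, hx]
    exact (disjoint_singleton.2 fun h => hcd (Subtype.ext h)).preimage _

theorem packingMeasure_univ_eq_top {s t : ℝ} (hs : 0 ≤ s) (hst : s < t)
    (h : ∃ᶠ n in atTop, 1 ≤ (cylinderCount m (n + 1) : ℝ≥0∞) * ENNReal.ofReal (α n) ^ t) :
    packingMeasure s (univ : Set (CantorUltrametric m α)) = ∞ := by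
  refine packingMeasure_univ_eq_top_of_prePacking (uniformMeasure m α) fun A hA => ?_
  refine iInf₂_eq_top.2 fun δ hδ => ?_
  have hhalf : ENNReal.ofReal (1 / 2) ^ s ≠ 0 := by
    rw [ENNReal.ofReal_rpow_of_pos (by norm_num)]
    exact (ENNReal.ofReal_pos.2 (by positivity)).ne'
  -- The gap `t - s` gives an unbounded factor that beats the constants `μ A` and `(1/2)^s`.
  have hlim : Tendsto (fun n => uniformMeasure m α A * ENNReal.ofReal (1 / 2) ^ s *
      (ENNReal.ofReal (α n) ^ (t - s))⁻¹) atTop (𝓝 ∞) := by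
    rw [← ENNReal.mul_top (mul_ne_zero hA hhalf)]
    refine ENNReal.Tendsto.const_mul (tendsto_inv_iff.1 ?_) (Or.inl ENNReal.top_ne_zero)
    have h0 := (ENNReal.tendsto_ofReal α.tendsto_zero).ennrpow_const (t - s)
    simpa [ENNReal.zero_rpow_of_pos (sub_pos.2 hst)] using h0
  refine ENNReal.eq_top_of_forall_nnreal_le fun R => ?_
  obtain ⟨n, hn, hnδ, hnR⟩ := (h.and_eventually
    ((α.tendsto_zero.eventually_le_const hδ).and
      (hlim.eventually_const_le (ENNReal.coe_lt_top (r := R))))).exists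
  refine hnR.trans (le_trans ?_ (le_prePackingDelta hs A hnδ))
  have hαpos : ENNReal.ofReal (α n) ≠ 0 := (ENNReal.ofReal_pos.2 (α.pos n)).ne'
  have hinv : (ENNReal.ofReal (α n) ^ (t - s))⁻¹ ≤
      (cylinderCount m (n + 1) : ℝ≥0∞) * ENNReal.ofReal (α n) ^ s := by
    rw [ENNReal.inv_le_iff_le_mul (by simp [(α.pos n).not_ge]) (by simp [(α.pos n).not_ge]),
      mul_left_comm,
      ← ENNReal.rpow_add _ _ hαpos ENNReal.ofReal_ne_top]
    simpa using hn
  have hdiv : ENNReal.ofReal (α n / 2) ^ s =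
      ENNReal.ofReal (1 / 2) ^ s * ENNReal.ofReal (α n) ^ s := by
    rw [← ENNReal.mul_rpow_of_nonneg _ _ hs, ← ENNReal.ofReal_mul (by norm_num)]
    congr 2
    ring
  calc _ ≤ uniformMeasure m α A * ENNReal.ofReal (1 / 2) ^ s *
        ((cylinderCount m (n + 1) : ℝ≥0∞) * ENNReal.ofReal (α n) ^ s) := by gcongr
    _ = _ := by
      rw [hdiv]
      ring

/-! ### The dimension formulas -/

theorem dimH_univ_eq_liminf (hm : ∀ i, 2 ≤ m i) :
    ((dimH (univ : Set (CantorUltrametric m α)) : ℝ≥0∞) : EReal) =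
      liminf (fun n : ℕ =>
        ((Real.log (cylinderCount m n) / (-Real.log (α n)) : ℝ) : EReal)) atTop := by
  have hlt1 := α.tendsto_zero.eventually_lt_const one_pos
  apply le_antisymm
  · refine EReal.le_of_forall_lt_iff_le.1 fun s hs => ?_
    have hs0 : (0 : EReal) ≤ s := (le_liminf_of_le (by isBoundedDefault)
      (log_quotient_nonneg_eventually (α := α) _ id tendsto_id)).trans hs.le
    lift s to ℝ≥0 using by exact_mod_cast hs0
    have hfr := (frequently_lt_of_liminf_lt (by isBoundedDefault) hs).and_eventually hlt1
    have hle := hausdorffMeasure_univ_le_one (m := m) (α := α) s.2 (hfr.mono fun n hn =>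
      ((natCast_mul_rpow_lt_one_iff (cylinderCount_pos n) (α.pos n) hn.2 s).2
        (by exact_mod_cast hn.1)).le)
    have := dimH_le_of_hausdorffMeasure_ne_top (hle.trans_lt ENNReal.one_lt_top).ne
    exact EReal.coe_ennreal_le_coe_ennreal_iff.2 this
  · refine EReal.ge_of_forall_gt_iff_ge.1 fun s hs => ?_
    rcases lt_or_ge s 0 with hs0 | hs0
    · exact le_trans (by exact_mod_cast hs0.le) (EReal.coe_ennreal_nonneg _)
    lift s to ℝ≥0 using hs0
    have hle := uniformMeasure_le_hausdorffMeasure (m := m) (α := α) hm s.2 (by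
      filter_upwards [eventually_lt_of_lt_liminf hs, hlt1] with n hn hn1
      refine not_lt.1 fun hcon => ?_
      have := (natCast_mul_rpow_lt_one_iff (cylinderCount_pos n) (α.pos n) hn1 s).1 hcon
      exact lt_asymm this (by exact_mod_cast hn))
    have hne : Measure.hausdorffMeasure (s : ℝ) (univ : Set (CantorUltrametric m α)) ≠ 0 :=
      fun h0 => by simpa [h0] using hle univ
    exact EReal.coe_ennreal_le_coe_ennreal_iff.2 (le_dimH_of_hausdorffMeasure_ne_zero hne)

theorem packingDim_eq_limsup :
    ((packingDim (CantorUltrametric m α) : ℝ≥0∞) : EReal) =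
      limsup (fun n : ℕ =>
        ((Real.log (cylinderCount m (n + 1)) / (-Real.log (α n)) : ℝ) : EReal)) atTop := by
  have hlt1 := α.tendsto_zero.eventually_lt_const one_pos
  apply le_antisymm
  · refine EReal.le_of_forall_lt_iff_le.1 fun s hs => ?_
    have hs0 : (0 : EReal) ≤ s := (le_limsup_of_frequently_le
      (log_quotient_nonneg_eventually (α := α) _ id tendsto_id).frequently
      (by isBoundedDefault)).trans hs.le
    lift s to ℝ≥0 using by exact_mod_cast hs0
    have hle : packingDim (CantorUltrametric m α) ≤ s := by
      refine iSup₂_le fun u hu => ?_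
      by_contra! hsu
      have hsu' : (s : ℝ) < u := by exact_mod_cast hsu
      refine ENNReal.one_ne_top (top_le_iff.1 (hu ▸ packingMeasure_univ_le_one u.2 ?_))
      filter_upwards [eventually_lt_of_limsup_lt hs, hlt1] with n hn hn1
      have hn' : Real.log (cylinderCount m (n + 1)) / (-Real.log (α n)) < s := by
        exact_mod_cast hn
      exact ((natCast_mul_rpow_lt_one_iff (cylinderCount_pos _) (α.pos n) hn1 u).2
        (hn'.trans hsu')).le
    exact EReal.coe_ennreal_le_coe_ennreal_iff.2 hle
  · refine EReal.ge_of_forall_gt_iff_ge.1 fun s hs => ?_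
    rcases lt_or_ge s 0 with hs0 | hs0
    · exact le_trans (by exact_mod_cast hs0.le) (EReal.coe_ennreal_nonneg _)
    lift s to ℝ≥0 using hs0
    obtain ⟨t, hst, ht⟩ := EReal.lt_iff_exists_real_btwn.1 hs
    have htop : packingMeasure (s : ℝ) (univ : Set (CantorUltrametric m α)) = ∞ := by
      refine packingMeasure_univ_eq_top s.2 (EReal.coe_lt_coe_iff.1 hst)
        (((frequently_lt_of_lt_limsup (by isBoundedDefault) ht).and_eventually hlt1).mono
          fun n hn => not_lt.1 fun hcon => ?_)
      have := (natCast_mul_rpow_lt_one_iff (cylinderCount_pos _) (α.pos n) hn.2 t).1 hcon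
      exact lt_asymm this (by exact_mod_cast hn.1)
    have hle : (s : ℝ≥0∞) ≤ packingDim (CantorUltrametric m α) :=
      le_iSup₂_of_le (f := fun (s : ℝ≥0) (_ : packingMeasure (s : ℝ)
        (univ : Set (CantorUltrametric m α)) = ∞) => (s : ℝ≥0∞)) s htop le_rfl
    exact EReal.coe_ennreal_le_coe_ennreal_iff.2 hle

end CantorUltrametric

theorem proposition3p6 (m : ℕ → ℕ) (hm : ∀ i, 2 ≤ m i) (α : ShrinkingSeq) :
    ((dimH (univ : Set (CantorUltrametric m α)) : ℝ≥0∞) : EReal) =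
        liminf (fun n : ℕ =>
          ((Real.log (∏ i ∈ Finset.range (n + 1), (m i : ℝ)) / (-Real.log (α (n + 1))) : ℝ) :
            EReal)) atTop ∧
      ((packingDim (CantorUltrametric m α) : ℝ≥0∞) : EReal) =
        limsup (fun n : ℕ =>
          ((Real.log (∏ i ∈ Finset.range (n + 1), (m i : ℝ)) / (-Real.log (α n)) : ℝ) :
            EReal)) atTop := by
  have : ∀ i, NeZero (m i) := fun i => ⟨by have := hm i; omega⟩
  have hcount : ∀ n, (∏ i ∈ Finset.range n, (m i : ℝ)) = (CantorUltrametric.cylinderCount m n : ℝ) :=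
    fun n => by simp [CantorUltrametric.cylinderCount]
  simp only [hcount]
  refine ⟨?_, CantorUltrametric.packingDim_eq_limsup⟩
  rw [CantorUltrametric.dimH_univ_eq_liminf hm]
  -- In the Hausdorff quotient both indices are shifted together, so this is only a reindexing.
  exact (liminf_nat_add _ 1).symm
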